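/- Let $X$ be a non-empty compact metric space with metric $d$, let $T:X\to X$ be a homeomorphism, and let $\mu$ be a $T$-invariant regular Borel probability measure on $X$; let $\mathcal B$ be the Borel $\sigma$-algebra. A subsequence of $\mathbb N$ is a strictly increasing sequence of natural numbers. Let $A=(a_i)_{i\ge 1}$ be a subsequence of $\mathbb N$ such that $(X,T)$ is $\mu$-$A$-equicontinuous: for every $\tau>0$ there is a compact set $K\subset X$ with $\mu(K)>1-\tau$ such that for every $\epsilon>0$ there is $\delta>0$ with $$x,y\in K,\ d(x,y)<\delta\ \Longrightarrow\ d(T^{a_n}x,T^{a_n}y)<\epsilon\quad\text{for all } n\ge 1 .$$ Then the following hold. 1. For every subsequence $S=(s_i)_{i\ge1}$ of $A$, the sequence entropy of $(X,\mathcal B,\mu,T)$ along $S$ vanishes: $$h_\mu^S(T)=\sup_{\xi}\ \limsup_{n\to\infty}\frac1n H_\mu\Big(\bigvee_{i=1}^n T^{-s_i}\xi\Big)=0,$$ where the supremum is over all finite measurable partitions $\xi$ of $X$, and $H_\mu(\eta)=-\sum_{C\in\eta}\mu(C)\log\mu(C)$ (with $0\log 0=0$) for a finite measurable partition $\eta$.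 2. $(X,\mathcal B,\mu,T)$ is rigid: there is a subsequence $(t_k)$ of $\mathbb N$ such that $f\circ T^{t_k}\to f$ in $L^2(\mu)$ for all $f\in L^2(\mu)$. -/

import Mathlib

open MeasureTheory Filter Topology

namespace MeasureRigidity

/-- A subsequence of the natural numbers: a strictly increasing sequence of natural numbers
(its terms are listed as `a 0 < a 1 < a 2 < ⋯`). -/
def IsSubseqNat (a : ℕ → ℕ) : Prop := StrictMono a

/-- `s` is a subsequence of the sequence `a`. -/
def IsSubseqOf (s a : ℕ → ℕ) : Prop := ∃ φ : ℕ → ℕ, StrictMono φ ∧ s = a ∘ φ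

/-- The set `K` is `A`-equicontinuous for `A = {a 0 < a 1 < ⋯}`. -/
def EquicontinuousAlong {X : Type*} [MetricSpace X] (T : X → X) (a : ℕ → ℕ) (K : Set X) : Prop :=
  ∀ ε : ℝ, 0 < ε → ∃ δ : ℝ, 0 < δ ∧ ∀ x ∈ K, ∀ y ∈ K, dist x y < δ →
    ∀ n : ℕ, dist (T^[a n] x) (T^[a n] y) < ε

/-- `(X, T)` is `μ`-`A`-equicontinuous for `A = {a 0 < a 1 < ⋯}`. -/
def MeasureEquicontinuousAlong {X : Type*} [MetricSpace X] [MeasurableSpace X]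
    (T : X → X) (μ : Measure X) (a : ℕ → ℕ) : Prop :=
  ∀ τ : ℝ, 0 < τ → ∃ K : Set X, IsCompact K ∧ μ.real K > 1 - τ ∧ EquicontinuousAlong T a K

/-- An indexed family of sets is a measurable partition of `X`. Empty cells are allowed; they
contribute nothing to the entropy. -/
structure IsMeasurablePartition {X ι : Type*} [MeasurableSpace X] (ξ : ι → Set X) : Prop where
  measurableSet : ∀ i, MeasurableSet (ξ i)
  disjoint : Pairwise fun i j => Disjoint (ξ i) (ξ j)
  iUnion_eq : ⋃ i, ξ i = Set.univ

/-- The entropy `H_μ(ξ) = - ∑ μ(ξ i) log μ(ξ i)` of a finite partition, with `0 log 0 = 0`. -/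
noncomputable def partitionEntropy {X ι : Type*} [MeasurableSpace X] [Fintype ι]
    (μ : Measure X) (ξ : ι → Set X) : ℝ :=
  -∑ i, μ.real (ξ i) * Real.log (μ.real (ξ i))

/-- The join of the partitions `T^{-s 0} ξ, …, T^{-s (n-1)} ξ` given by the first `n` terms of `s`.
Its cells are the intersections `⋂ i < n, T^{-s i} (ξ (w i))`, indexed by words `w` of length `n`. -/
def joinAlong {X ι : Type*} (T : X → X) (s : ℕ → ℕ) (ξ : ι → Set X) (n : ℕ) :
    (Fin n → ι) → Set X :=
  fun w => ⋂ i : Fin n, T^[s i] ⁻¹' ξ (w i)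

/-- The sequence entropy `h_μ^S(T, ξ)` of a finite partition `ξ` along `S = {s 0 < s 1 < ⋯}`. -/
noncomputable def seqEntropyOf {X ι : Type*} [MeasurableSpace X] [Fintype ι]
    (T : X → X) (μ : Measure X) (s : ℕ → ℕ) (ξ : ι → Set X) : EReal :=
  limsup (fun n : ℕ => ((1 / (n : ℝ) * partitionEntropy μ (joinAlong T s ξ n) : ℝ) : EReal)) atTop

/-- The sequence entropy `h_μ^S(T)`: the supremum of `h_μ^S(T, ξ)` over all finite measurable
partitions `ξ`. -/
noncomputable def seqEntropy {X : Type*} [MeasurableSpace X]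
    (T : X → X) (μ : Measure X) (s : ℕ → ℕ) : EReal :=
  ⨆ (k : ℕ) (ξ : Fin k → Set X) (_ : IsMeasurablePartition ξ), seqEntropyOf T μ s ξ

/-- The measure preserving system is rigid: there is a strictly increasing sequence `t` of natural
numbers with `f ∘ T^{t k} → f` in `L²(μ)` for every complex-valued `f` in `L²(μ)`. -/
def IsRigid {X : Type*} [MeasurableSpace X] {T : X → X} {μ : Measure X}
    (hT : MeasurePreserving T μ μ) : Prop :=
  ∃ t : ℕ → ℕ, IsSubseqNat t ∧ ∀ f : Lp ℂ 2 μ,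
    Tendsto (fun k : ℕ => Lp.compMeasurePreserving (T^[t k]) (hT.iterate (t k)) f) atTop (𝓝 f)

end MeasureRigidity

/-! Both conclusions follow from one fact, `MeasureEquicontinuousAlong.totallyBounded_orbit`: for
every `f` in L² the set of all `f ∘ T^{a n}` is totally bounded. For continuous `f` this is an
Arzelà–Ascoli argument on a compact `K` of nearly full measure, the complement costing little in L²;
density of continuous functions and the isometry of composition with `T^{a n}` give the rest.

Entropy: applied to the labelling function of a partition, the fact says that each `T^{-s i} ξ`
agrees, up to small measure, with one of finitely many partitions. The join of `n` terms is then
determined by a fixed finite join and `n` partitions of entropy at most `ε`, so its entropy is at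
most `C + n ε` (`fiberEntropy_pi_le`).

Rigidity: by pigeonhole, finitely many `g j` have `g j ∘ T^{a n}` close to `g j ∘ T^{a m}` for some
`n` far beyond `m`. The isometry cancels `T^{a m}`, so `a n - a m` is an approximate return time.
Diagonalizing over a dense sequence finishes the proof. -/

namespace MeasureRigidity

/-! ### Entropy of finite-valued functions -/

section Entropy

variable {X : Type*} [MeasurableSpace X] {μ : Measure X} [IsProbabilityMeasure μ]

/-- The Shannon entropy of the partition of `X` into the fibres of `f`. -/
noncomputable def fiberEntropy {ι : Type*} [Fintype ι] (μ : Measure X) (f : X → ι) : ℝ :=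
  ∑ i, Real.negMulLog (μ.real (f ⁻¹' {i}))

/-- All fibres of `f` are measurable. -/
def MeasurableFibers {ι : Type*} (f : X → ι) : Prop := ∀ i, MeasurableSet (f ⁻¹' {i})

theorem fiberEntropy_nonneg {ι : Type*} [Fintype ι] (f : X → ι) :
    0 ≤ fiberEntropy μ f :=
  Finset.sum_nonneg fun _ _ => Real.negMulLog_nonneg measureReal_nonneg measureReal_le_one

theorem MeasurableFibers.preimage {ι : Type*} [Finite ι] {f : X → ι} (hf : MeasurableFibers f)
    (s : Set ι) : MeasurableSet (f ⁻¹' s) := by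
  rw [← Set.biUnion_preimage_singleton]
  exact MeasurableSet.biUnion s.to_countable fun i _ => hf i

theorem MeasurableFibers.comp {ι κ : Type*} [Finite ι] {f : X → ι} (hf : MeasurableFibers f)
    (φ : ι → κ) : MeasurableFibers (fun x => φ (f x)) :=
  fun j => hf.preimage (φ ⁻¹' {j})

theorem MeasurableFibers.comp_measurable {ι : Type*} {f : X → ι} (hf : MeasurableFibers f)
    {S : X → X} (hS : Measurable S) : MeasurableFibers (fun x => f (S x)) :=
  fun j => hS (hf j)

theorem MeasurableFibers.prodMk {ι κ : Type*} {f : X → ι} {g : X → κ} (hf : MeasurableFibers f)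
    (hg : MeasurableFibers g) : MeasurableFibers (fun x => (f x, g x)) := by
  rintro ⟨i, j⟩
  convert (hf i).inter (hg j) using 1
  ext x
  simp

theorem MeasurableFibers.pi {α ι : Type*} [Countable α] {f : α → X → ι}
    (hf : ∀ a, MeasurableFibers (f a)) : MeasurableFibers (fun x a => f a x) := by
  intro w
  convert MeasurableSet.iInter fun a => hf a (w a) using 1
  ext x
  simp [funext_iff]

theorem measureReal_preimage_eq_sum {ι : Type*} [Fintype ι] {f : X → ι} (hf : MeasurableFibers f)
    (t : Finset ι) : μ.real (f ⁻¹' ↑t) = ∑ i ∈ t, μ.real (f ⁻¹' {i}) := by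
  rw [← Set.biUnion_preimage_singleton]
  refine measureReal_biUnion_finset ?_ fun i _ => hf i
  intro i _ j _ hij
  exact Disjoint.preimage f (by simpa using hij)

theorem sum_measureReal_fiber {ι : Type*} [Fintype ι] {f : X → ι} (hf : MeasurableFibers f) :
    ∑ i, μ.real (f ⁻¹' {i}) = 1 := by
  rw [← measureReal_preimage_eq_sum hf]
  simp

/-- The entropy does not increase when the partition is coarsened. -/
theorem fiberEntropy_comp_le {ι κ : Type*} [Fintype ι] [Fintype κ] {f : X → ι}
    (hf : MeasurableFibers f) (φ : ι → κ) :
    fiberEntropy μ (fun x => φ (f x)) ≤ fiberEntropy μ f := by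
  classical
  unfold fiberEntropy
  rw [← Finset.sum_fiberwise (s := Finset.univ) (g := φ)
    (f := fun i => Real.negMulLog (μ.real (f ⁻¹' {i})))]
  refine Finset.sum_le_sum fun j _ => ?_
  have hsum : μ.real ((fun x => φ (f x)) ⁻¹' {j}) =
      ∑ i with φ i = j, μ.real (f ⁻¹' {i}) := by
    rw [← measureReal_preimage_eq_sum hf]
    congr 1
    ext x
    simp
  -- With `S = ∑ pᵢ`, write `-S log S = ∑ -pᵢ log S` and use `log pᵢ ≤ log S`.
  rw [hsum, Real.negMulLog, neg_mul, Finset.sum_mul, ← Finset.sum_neg_distrib]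
  refine Finset.sum_le_sum fun i hi => ?_
  rw [Real.negMulLog, neg_mul, neg_le_neg_iff]
  rcases (measureReal_nonneg (μ := μ) (s := f ⁻¹' {i})).eq_or_lt with h0 | h0
  · simp [← h0]
  · refine mul_le_mul_of_nonneg_left (Real.log_le_log h0 ?_) h0.le
    exact Finset.single_le_sum (f := fun i => μ.real (f ⁻¹' {i}))
      (fun _ _ => measureReal_nonneg) hi

/-- This is `log x ≤ x - 1` at `x = p q / r`, times `r`. For a joint law with marginals `p` and `q`,
the error `p q - r` sums to zero. -/
theorem negMulLog_le_of_le {p q r : ℝ} (hr : 0 ≤ r) (hrp : r ≤ p) (hrq : r ≤ q) :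
    Real.negMulLog r ≤ -(r * Real.log p) - r * Real.log q + (p * q - r) := by
  rcases hr.eq_or_lt with rfl | hr
  · simpa using mul_nonneg hrp hrq
  · have hp := hr.trans_le hrp
    have hq := hr.trans_le hrq
    have h := Real.log_le_sub_one_of_pos (div_pos (mul_pos hp hq) hr)
    rw [Real.log_div (mul_pos hp hq).ne' hr.ne', Real.log_mul hp.ne' hq.ne'] at h
    have h2 := mul_le_mul_of_nonneg_left h hr.le
    have h3 : r * (p * q / r - 1) = p * q - r := by field_simp
    rw [h3] at h2
    rw [Real.negMulLog]
    linarith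

/-- Subadditivity of the entropy. -/
theorem fiberEntropy_prodMk_le {ι κ : Type*} [Fintype ι] [Fintype κ] {f : X → ι} {g : X → κ}
    (hf : MeasurableFibers f) (hg : MeasurableFibers g) :
    fiberEntropy μ (fun x => (f x, g x)) ≤ fiberEntropy μ f + fiberEntropy μ g := by
  classical
  set r : ι → κ → ℝ := fun i j => μ.real ((fun x => (f x, g x)) ⁻¹' {(i, j)}) with hr
  set p : ι → ℝ := fun i => μ.real (f ⁻¹' {i}) with hp
  set q : κ → ℝ := fun j => μ.real (g ⁻¹' {j}) with hq
  have hfg := hf.prodMk hg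
  have hrow : ∀ i, ∑ j, r i j = p i := by
    intro i
    have h := measureReal_preimage_eq_sum (μ := μ) hfg ({i} ×ˢ Finset.univ)
    rw [Finset.sum_product, Finset.sum_singleton] at h
    rw [hr, ← h, hp]
    congr 1
    ext x
    simp [eq_comm]
  have hcol : ∀ j, ∑ i, r i j = q j := by
    intro j
    have h := measureReal_preimage_eq_sum (μ := μ) hfg (Finset.univ ×ˢ {j})
    rw [Finset.sum_product] at h
    simp only [Finset.sum_singleton] at h
    rw [hr, ← h, hq]
    congr 1
    ext x
    simp [eq_comm]
  have hr0 : ∀ i j, 0 ≤ r i j := fun _ _ => measureReal_nonneg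
  have hbound : ∀ i j, Real.negMulLog (r i j) ≤
      -(r i j * Real.log (p i)) - r i j * Real.log (q j) + (p i * q j - r i j) := by
    intro i j
    refine negMulLog_le_of_le (hr0 i j) ?_ ?_
    · rw [← hrow]
      exact Finset.single_le_sum (f := fun j => r i j) (fun _ _ => hr0 _ _) (Finset.mem_univ j)
    · rw [← hcol]
      exact Finset.single_le_sum (f := fun i => r i j) (fun _ _ => hr0 _ _) (Finset.mem_univ i)
  have hp1 : ∑ i, p i = 1 := sum_measureReal_fiber hf
  have hq1 : ∑ j, q j = 1 := sum_measureReal_fiber hg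
  have e1 : ∑ i, ∑ j, r i j * Real.log (p i) = ∑ i, p i * Real.log (p i) := by
    simp_rw [← Finset.sum_mul, hrow]
  have e2 : ∑ i, ∑ j, r i j * Real.log (q j) = ∑ j, q j * Real.log (q j) := by
    rw [Finset.sum_comm]
    simp_rw [← Finset.sum_mul, hcol]
  have e3 : ∑ i, ∑ j, (p i * q j - r i j) = 0 := by
    simp_rw [Finset.sum_sub_distrib, ← Finset.mul_sum, hq1, hrow, mul_one, sub_self]
  have key : fiberEntropy μ (fun x => (f x, g x)) = ∑ i, ∑ j, Real.negMulLog (r i j) :=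
    Fintype.sum_prod_type _
  rw [key]
  refine (Finset.sum_le_sum fun i _ => Finset.sum_le_sum fun j _ => hbound i j).trans ?_
  simp_rw [Finset.sum_add_distrib, Finset.sum_sub_distrib, Finset.sum_neg_distrib] at e3 ⊢
  rw [e3, e1, e2, fiberEntropy, fiberEntropy]
  simp_rw [Real.negMulLog, neg_mul, Finset.sum_neg_distrib]
  apply le_of_eq
  ring

theorem MeasurableFibers.mismatch {ι : Type*} [Finite ι] [DecidableEq ι] {f g : X → ι}
    (hf : MeasurableFibers f) (hg : MeasurableFibers g) :
    MeasurableFibers (fun x => if f x = g x then none else some (f x)) :=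
  (hf.prodMk hg).comp fun p : ι × ι => if p.1 = p.2 then none else some p.1

/-- The function recording where, and with which value, `f` differs from `g` has small entropy
if `f` and `g` agree up to a set of small measure. -/
theorem exists_fiberEntropy_mismatch_le (μ : Measure X) [IsProbabilityMeasure μ] (ι : Type*)
    [Fintype ι] [DecidableEq ι] {ε : ℝ} (hε : 0 < ε) :
    ∃ δ : ℝ, 0 < δ ∧ ∀ f g : X → ι, MeasurableFibers f → MeasurableFibers g →
      μ.real {x | f x ≠ g x} < δ →
      fiberEntropy μ (fun x => if f x = g x then none else some (f x)) ≤ ε := by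
  -- Each cell gets an equal share of `ε`. The cell of `none` has mass near 1 and the others near 0,
  -- and `Real.negMulLog` vanishes at both points.
  set η : ℝ := ε / Fintype.card (Option ι) with hη
  have hη0 : 0 < η := div_pos hε (by exact_mod_cast Fintype.card_pos)
  have h0 := Metric.continuousAt_iff.1 (Real.continuous_negMulLog.continuousAt (x := 0)) η hη0
  have h1 := Metric.continuousAt_iff.1 (Real.continuous_negMulLog.continuousAt (x := 1)) η hη0
  obtain ⟨δ₀, hδ₀, h0⟩ := h0
  obtain ⟨δ₁, hδ₁, h1⟩ := h1
  refine ⟨min δ₀ δ₁, lt_min hδ₀ hδ₁, fun f g hf hg hfg => ?_⟩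
  set D : X → Option ι := fun x => if f x = g x then none else some (f x) with hD
  have hDm : MeasurableFibers D := hf.mismatch hg
  have hne : {x | f x ≠ g x} = (D ⁻¹' {none})ᶜ := by
    ext x
    simp [hD]
  have hcell : ∀ o, Real.negMulLog (μ.real (D ⁻¹' {o})) ≤ η := by
    rintro (_ | i)
    · have hd : dist (μ.real (D ⁻¹' {none})) 1 < δ₁ := by
        have := hfg.trans_le (min_le_right _ _)
        rw [hne, probReal_compl_eq_one_sub (hDm none)] at this
        rwa [dist_comm, Real.dist_eq, abs_of_nonneg (sub_nonneg.2 measureReal_le_one)]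
      have := h1 hd
      rw [Real.negMulLog_one, Real.dist_eq, sub_zero] at this
      exact (le_abs_self _).trans this.le
    · have hd : dist (μ.real (D ⁻¹' {some i})) 0 < δ₀ := by
        rw [Real.dist_eq, sub_zero, abs_of_nonneg measureReal_nonneg]
        refine lt_of_le_of_lt (measureReal_mono ?_) (hfg.trans_le (min_le_left _ _))
        rw [hne]
        intro x hx
        simp only [Set.mem_preimage, Set.mem_singleton_iff] at hx
        simp [hx]
      have := h0 hd
      rw [Real.negMulLog_zero, Real.dist_eq, sub_zero] at this
      exact (le_abs_self _).trans this.le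
  calc fiberEntropy μ D ≤ ∑ _o : Option ι, η := Finset.sum_le_sum fun o _ => hcell o
    _ = ε := by
      rw [Finset.sum_const, Finset.card_univ, nsmul_eq_mul, hη]
      exact mul_div_cancel₀ _ (by exact_mod_cast Fintype.card_ne_zero)

/-- If every `f n` agrees with one of finitely many functions `g b` up to a function of entropy at
most `ε`, then the entropy of `(f 0, …, f (n - 1))` grows at most at rate `ε`. -/
theorem fiberEntropy_pi_le {ι β : Type*} [Fintype ι] [DecidableEq ι] [Fintype β] [DecidableEq β]
    {f : ℕ → X → ι} (hf : ∀ n, MeasurableFibers (f n)) {g : β → X → ι}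
    (hg : ∀ b, MeasurableFibers (g b)) {ε : ℝ} (c : ℕ → β)
    (hc : ∀ n, fiberEntropy μ
      (fun x => if f n x = g (c n) x then none else some (f n x)) ≤ ε) (n : ℕ) :
    fiberEntropy μ (fun x (i : Fin n) => f i x) ≤ fiberEntropy μ (fun x b => g b x) + n * ε := by
  have hG : MeasurableFibers (fun x b => g b x) := .pi hg
  have hF : ∀ n : ℕ, MeasurableFibers (fun x (i : Fin n) => f i x) := fun n => .pi fun i => hf i
  -- Keeping all `g b` in the join makes the induction work: `g (c n)` and the mismatch function
  -- together recover `f n`, by `Option.getD`.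
  have hJ : ∀ n : ℕ, fiberEntropy μ (fun x => ((fun b => g b x), fun i : Fin n => f i x)) ≤
      fiberEntropy μ (fun x b => g b x) + n * ε := by
    intro n
    induction n with
    | zero =>
      rw [Nat.cast_zero, zero_mul, add_zero]
      convert fiberEntropy_comp_le (μ := μ) hG
        fun w => ((w, fun i => i.elim0) : (β → ι) × (Fin 0 → ι)) using 4
    | succ n ih =>
      have hJm := hG.prodMk (hF n)
      have hDm := (hf n).mismatch (hg (c n))
      have h1 := fiberEntropy_prodMk_le (μ := μ) hJm hDm
      have h2 := fiberEntropy_comp_le (μ := μ) (hJm.prodMk hDm)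
        fun p : ((β → ι) × (Fin n → ι)) × Option ι =>
          ((p.1.1, Fin.snoc p.1.2 (p.2.getD (p.1.1 (c n)))) : (β → ι) × (Fin (n + 1) → ι))
      have h3 : (fun x => ((fun b => g b x), fun i : Fin (n + 1) => f i x)) =
          fun x => ((fun b => g b x), Fin.snoc (fun i : Fin n => f i x)
            ((if f n x = g (c n) x then none else some (f n x)).getD (g (c n) x))) := by
        funext x
        refine Prod.ext rfl (funext fun i => ?_)
        refine Fin.lastCases ?_ (fun j => ?_) i
        · by_cases h : f n x = g (c n) x <;> simp [h]
        · simp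
      rw [h3]
      refine (h2.trans h1).trans ?_
      have := hc n
      push_cast
      linarith
  exact (fiberEntropy_comp_le (μ := μ) (hG.prodMk (hF n)) Prod.snd).trans (hJ n)

end Entropy


/-! ### Precompact orbits in `L²` -/

/-- The centres are terms of the sequence itself, so approximants of an orbit again lie in the
orbit. -/
theorem exists_finset_of_totallyBounded_range {Y : Type*} [PseudoMetricSpace Y] {u : ℕ → Y}
    (hu : TotallyBounded (Set.range u)) {ε : ℝ} (hε : 0 < ε) :
    ∃ F : Finset ℕ, ∀ n, ∃ m ∈ F, dist (u n) (u m) < ε := by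
  classical
  obtain ⟨t, hts, htf, hcov⟩ := Metric.finite_approx_of_totallyBounded hu ε hε
  lift t to Finset Y using htf
  obtain ⟨F, -, hF⟩ := Finset.subset_set_image_iff.1 (Set.image_univ (f := u) ▸ hts)
  refine ⟨F, fun n => ?_⟩
  obtain ⟨y, hy, hny⟩ := Set.mem_iUnion₂.1 (hcov (Set.mem_range_self n))
  rw [← hF] at hy
  obtain ⟨m, hm, rfl⟩ := Finset.mem_image.1 hy
  exact ⟨m, hm, hny⟩

theorem totallyBounded_range_of_exists_finset {Y : Type*} [PseudoMetricSpace Y] {u : ℕ → Y}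
    (h : ∀ ε > 0, ∃ F : Finset ℕ, ∀ n, ∃ m ∈ F, dist (u n) (u m) < ε) :
    TotallyBounded (Set.range u) := by
  refine Metric.totallyBounded_iff.2 fun ε hε => ?_
  obtain ⟨F, hF⟩ := h ε hε
  refine ⟨u '' F, F.finite_toSet.image u, ?_⟩
  rintro _ ⟨n, rfl⟩
  obtain ⟨m, hm, hnm⟩ := hF n
  exact Set.mem_iUnion₂.2 ⟨u m, ⟨m, hm, rfl⟩, hnm⟩

/-- For isometries `U n`, total boundedness of `{U n y}` is a closed condition on `y`. -/
theorem totallyBounded_range_of_dense {Y Z : Type*} [PseudoMetricSpace Y] [PseudoMetricSpace Z]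
    {U : ℕ → Y → Z} (hU : ∀ n, Isometry (U n)) {s : Set Y} (hs : Dense s)
    (h : ∀ y ∈ s, TotallyBounded (Set.range fun n => U n y)) (y : Y) :
    TotallyBounded (Set.range fun n => U n y) := by
  refine totallyBounded_range_of_exists_finset fun ε hε => ?_
  obtain ⟨z, hz, hyz⟩ := Metric.dense_iff.1 hs y (ε / 3) (by positivity)
  obtain ⟨F, hF⟩ := exists_finset_of_totallyBounded_range (h _ hyz) (ε := ε / 3) (by positivity)
  refine ⟨F, fun n => ?_⟩
  obtain ⟨m, hm, hnm⟩ := hF n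
  refine ⟨m, hm, ?_⟩
  have hzy : dist y z < ε / 3 := by rw [dist_comm]; exact hz
  have h4 := dist_triangle4 (U n y) (U n z) (U m z) (U m y)
  rw [(hU n).dist_eq, (hU m).dist_eq, dist_comm z y] at h4
  linarith

/-- Minkowski's inequality for the pointwise bound `‖h‖ ≤ ε + M · 1_{Kᶜ}`. -/
theorem eLpNorm_two_le_of_norm_le {X : Type*} [MeasurableSpace X] {μ : Measure X}
    [IsProbabilityMeasure μ] {h : X → ℂ} {K : Set X} (hK : MeasurableSet K) {ε M τ : ℝ}
    (hε : 0 ≤ ε) (hM : 0 ≤ M) (hhε : ∀ x ∈ K, ‖h x‖ ≤ ε) (hhM : ∀ x, ‖h x‖ ≤ M)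
    (hτ : μ.real Kᶜ ≤ τ) : eLpNorm h 2 μ ≤ ENNReal.ofReal (ε + M * √τ) := by
  have hmono : eLpNorm h 2 μ ≤
      eLpNorm ((fun _ => ε) + Kᶜ.indicator fun _ => M : X → ℝ) 2 μ := by
    refine eLpNorm_mono fun x => ?_
    rw [Pi.add_apply, Real.norm_eq_abs]
    refine le_trans ?_ (le_abs_self _)
    by_cases hx : x ∈ K
    · simpa [hx] using hhε x hx
    · simpa [hx] using (hhM x).trans (le_add_of_nonneg_left hε)
  refine hmono.trans ((eLpNorm_add_le aestronglyMeasurable_const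
    (aestronglyMeasurable_const.indicator hK.compl) (by norm_num)).trans ?_)
  rw [eLpNorm_const _ (by norm_num) (NeZero.ne μ), eLpNorm_indicator_const hK.compl (by norm_num)
    (by norm_num), measure_univ, ENNReal.one_rpow, mul_one, ENNReal.ofReal_add hε (by positivity),
    ENNReal.ofReal_mul hM, Real.enorm_of_nonneg hε, Real.enorm_of_nonneg hM]
  gcongr
  rw [Real.sqrt_eq_rpow, ← ENNReal.ofReal_rpow_of_nonneg (measureReal_nonneg.trans hτ)
    (by norm_num), ENNReal.toReal_ofNat]
  gcongr
  rw [← ofReal_measureReal]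
  exact ENNReal.ofReal_le_ofReal hτ

section Orbit

variable {X : Type*} [MetricSpace X] [CompactSpace X]

/-- Up to `ε`, the restrictions of the functions `f ∘ T^{a n}` to a compact `A`-equicontinuous set
are finitely many. -/
theorem EquicontinuousAlong.exists_finset {T : X → X} {a : ℕ → ℕ} {K : Set X}
    (hK : EquicontinuousAlong T a K) (f : C(X, ℂ)) {ε : ℝ} (hε : 0 < ε) :
    ∃ F : Finset ℕ, ∀ n, ∃ m ∈ F, ∀ x ∈ K, dist (f (T^[a n] x)) (f (T^[a m] x)) < ε := by
  obtain ⟨η, hη, hf⟩ := Metric.uniformContinuous_iff.1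
    (CompactSpace.uniformContinuous_of_continuous f.continuous) (ε / 3) (by positivity)
  obtain ⟨δ, hδ, hT⟩ := hK η hη
  obtain ⟨t, htK, htf, hcov⟩ := Metric.finite_approx_of_totallyBounded
    (isCompact_univ.totallyBounded.subset (Set.subset_univ K)) δ hδ
  have := htf.fintype
  -- Equicontinuity reduces the problem to values on the finite net `t`, which lie in a ball of the
  -- finite-dimensional space `t → ℂ`.
  have hbdd : TotallyBounded (Set.range fun n (x : t) => f (T^[a n] x)) := by
    refine (isCompact_closedBall (0 : t → ℂ) ‖f‖).totallyBounded.subset ?_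
    rintro _ ⟨n, rfl⟩
    rw [mem_closedBall_zero_iff, pi_norm_le_iff_of_nonneg (norm_nonneg f)]
    exact fun x => f.norm_coe_le_norm _
  obtain ⟨F, hF⟩ := exists_finset_of_totallyBounded_range hbdd (ε := ε / 3) (by positivity)
  refine ⟨F, fun n => ?_⟩
  obtain ⟨m, hm, hnm⟩ := hF n
  refine ⟨m, hm, fun x hx => ?_⟩
  obtain ⟨y, hy, hxy⟩ := Set.mem_iUnion₂.1 (hcov hx)
  have h1 := hf (hT x hx y (htK hy) hxy n)
  have h2 := hf (hT x hx y (htK hy) hxy m)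
  have h3 := (dist_pi_lt_iff (by positivity)).1 hnm ⟨y, hy⟩
  have h4 := dist_triangle4 (f (T^[a n] x)) (f (T^[a n] y)) (f (T^[a m] y)) (f (T^[a m] x))
  rw [dist_comm (f (T^[a m] y))] at h4
  linarith

variable [MeasurableSpace X] [BorelSpace X] {T : X → X} {μ : Measure X} [IsProbabilityMeasure μ]

theorem MeasureEquicontinuousAlong.totallyBounded_orbit (hT : MeasurePreserving T μ μ)
    {a : ℕ → ℕ} (hequi : MeasureEquicontinuousAlong T μ a) (f : Lp ℂ 2 μ) :
    TotallyBounded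
      (Set.range fun n => Lp.compMeasurePreserving (T^[a n]) (hT.iterate (a n)) f) := by
  refine totallyBounded_range_of_dense
    (fun n => Lp.isometry_compMeasurePreserving (hT.iterate (a n)))
    (ContinuousMap.toLp_denseRange ℂ μ ℂ (p := 2) (by norm_num)) ?_ f
  rintro _ ⟨f, rfl⟩
  refine totallyBounded_range_of_exists_finset fun ε hε => ?_
  set M : ℝ := 2 * ‖f‖ with hM
  have hM0 : 0 ≤ M := by positivity
  -- Chosen so that `M * √τ < ε / 2`; `M + 1` avoids division by zero when `f = 0`.
  set τ : ℝ := (ε / (2 * (M + 1))) ^ 2 with hτ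
  obtain ⟨K, hKc, hKμ, hK⟩ := hequi τ (by positivity)
  obtain ⟨F, hF⟩ := hK.exists_finset f (ε := ε / 2) (by positivity)
  refine ⟨F, fun n => ?_⟩
  obtain ⟨m, hm, hnm⟩ := hF n
  refine ⟨m, hm, ?_⟩
  have hKτ : μ.real Kᶜ ≤ τ := by
    rw [probReal_compl_eq_one_sub hKc.measurableSet]
    linarith
  have hbound := eLpNorm_two_le_of_norm_le (μ := μ)
    (h := fun x => f (T^[a n] x) - f (T^[a m] x)) hKc.measurableSet (half_pos hε).le hM0
    (fun x hx => by rw [← dist_eq_norm]; exact (hnm x hx).le)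
    (fun x => (norm_sub_le _ _).trans (by
      rw [hM, two_mul]
      exact add_le_add (f.norm_coe_le_norm _) (f.norm_coe_le_norm _))) hKτ
  have hlt : ε / 2 + M * √τ < ε := by
    rw [hτ, Real.sqrt_sq (by positivity)]
    have : M * (ε / (2 * (M + 1))) < ε / 2 := by
      rw [mul_div_assoc', div_lt_div_iff₀ (by positivity) (by positivity)]
      nlinarith
    linarith
  have hcoe : ∀ k, (Lp.compMeasurePreserving (T^[k]) (hT.iterate k)
      (ContinuousMap.toLp 2 μ ℂ f) : X → ℂ) =ᵐ[μ] fun x => f (T^[k] x) := fun k =>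
    (Lp.coeFn_compMeasurePreserving _ _).trans
      ((hT.iterate k).quasiMeasurePreserving.ae_eq_comp (ContinuousMap.coeFn_toLp μ f))
  rw [Lp.dist_def]
  refine lt_of_le_of_lt ?_ hlt
  rw [eLpNorm_congr_ae ((hcoe (a n)).sub (hcoe (a m)))]
  exact ENNReal.toReal_le_of_le_ofReal (by positivity) hbound

end Orbit


/-! ### Rigidity -/

/-- Among finitely many sequences with totally bounded range, two arbitrarily distant indices have
nearly the same values simultaneously. -/
theorem exists_lt_dist_lt_of_totallyBounded {Y α : Type*} [PseudoMetricSpace Y] [Finite α]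
    {u : α → ℕ → Y} (hu : ∀ j, TotallyBounded (Set.range (u j))) {ε : ℝ} (hε : 0 < ε) (N : ℕ) :
    ∃ m n, m + N < n ∧ ∀ j, dist (u j n) (u j m) < ε := by
  choose F hF using fun j =>
    exists_finset_of_totallyBounded_range (hu j) (ε := ε / 2) (by positivity)
  choose c hcF hc using hF
  -- Pigeonhole on the whole vector of centres, so that one pair of indices serves every `j`.
  obtain ⟨w, hw⟩ := Finite.exists_infinite_fiber fun n j => (⟨c j n, hcF j n⟩ : F j)
  rw [Set.infinite_coe_iff] at hw
  obtain ⟨m, hm⟩ := hw.nonempty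
  obtain ⟨n, hn, hmn⟩ := hw.exists_gt (m + N)
  refine ⟨m, n, hmn, fun j => ?_⟩
  have e : c j n = c j m := by
    have := congrFun (hn.trans hm.symm) j
    simpa using this
  have h1 := hc j n
  have h2 := hc j m
  rw [e] at h1
  linarith [dist_triangle_right (u j n) (u j m) (u j (c j m))]

/-- `U^{n - m} f` is as far from `f` as `U^n f` is from `U^m f`, `U` being an isometry. -/
theorem dist_compMeasurePreserving_iterate_sub {X : Type*} [MeasurableSpace X] {T : X → X}
    {μ : Measure X} (hT : MeasurePreserving T μ μ) (f : Lp ℂ 2 μ) {m n : ℕ} (hmn : m ≤ n) :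
    dist (Lp.compMeasurePreserving (T^[n - m]) (hT.iterate (n - m)) f) f =
      dist (Lp.compMeasurePreserving (T^[n]) (hT.iterate n) f)
        (Lp.compMeasurePreserving (T^[m]) (hT.iterate m) f) := by
  obtain ⟨k, rfl⟩ := Nat.exists_eq_add_of_le hmn
  have hiter (k : ℕ) : Lp.compMeasurePreserving (T^[k]) (hT.iterate k) f =
      (Lp.compMeasurePreserving T hT)^[k] f :=
    (congrFun (Lp.compMeasurePreserving_iterate hT k) f).symm
  have hadd : Lp.compMeasurePreserving (T^[m + k]) (hT.iterate (m + k)) f =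
      Lp.compMeasurePreserving (T^[m]) (hT.iterate m)
        (Lp.compMeasurePreserving (T^[k]) (hT.iterate k) f) := by
    rw [hiter, hiter, Function.iterate_add_apply, Lp.compMeasurePreserving_iterate]
  simp only [Nat.add_sub_cancel_left]
  rw [hadd, (Lp.isometry_compMeasurePreserving (hT.iterate m)).dist_eq]

theorem isRigid_of_totallyBounded_orbit {X : Type*} [MeasurableSpace X] {T : X → X}
    {μ : Measure X} (hT : MeasurePreserving T μ μ) [TopologicalSpace.SeparableSpace (Lp ℂ 2 μ)]
    {a : ℕ → ℕ} (ha : StrictMono a)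
    (h : ∀ f : Lp ℂ 2 μ, TotallyBounded
      (Set.range fun n => Lp.compMeasurePreserving (T^[a n]) (hT.iterate (a n)) f)) :
    IsRigid hT := by
  set U : ℕ → Lp ℂ 2 μ → Lp ℂ 2 μ :=
    fun n f => Lp.compMeasurePreserving (T^[n]) (hT.iterate n) f
  have hU : ∀ n, Isometry (U n) := fun n => Lp.isometry_compMeasurePreserving (hT.iterate n)
  set g := TopologicalSpace.denseSeq (Lp ℂ 2 μ)
  have hfreq : ∀ k : ℕ, ∃ᶠ t in atTop, ∀ j : Fin (k + 1),
      dist (U t (g j)) (g j) < 1 / ((k : ℝ) + 1) := by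
    intro k
    refine frequently_atTop.2 fun N => ?_
    obtain ⟨m, n, hmn, hd⟩ := exists_lt_dist_lt_of_totallyBounded
      (fun j : Fin (k + 1) => h (g j)) (Nat.one_div_pos_of_nat (α := ℝ) (n := k)) N
    have hle : m ≤ n := by omega
    refine ⟨a n - a m, ?_, fun j => ?_⟩
    -- Strict monotonicity gives `a n - a m ≥ n - m > N`, so return times are unbounded.
    · obtain ⟨l, rfl⟩ := Nat.exists_eq_add_of_le hle
      have := ha.add_le_nat l m
      rw [add_comm l m] at this
      omega
    · have := dist_compMeasurePreserving_iterate_sub hT (g j) (ha.monotone hle)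
      exact this.trans_lt (hd j)
  obtain ⟨t, ht, htd⟩ := extraction_forall_of_frequently hfreq
  refine ⟨t, ht, fun f => Metric.tendsto_atTop.2 fun ε hε => ?_⟩
  obtain ⟨j, hj⟩ := (TopologicalSpace.denseRange_denseSeq (Lp ℂ 2 μ)).exists_dist_lt f
    (ε := ε / 3) (by positivity)
  obtain ⟨N, hN⟩ := exists_nat_one_div_lt (ε := ε / 3) (by positivity)
  -- `k ≥ j` puts `g j` among the functions controlled at stage `k`; `k ≥ N` makes the tolerance
  -- less than `ε / 3`.
  refine ⟨max j N, fun k hk => ?_⟩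
  have h1 : dist (U (t k) (g j)) (g j) < ε / 3 := by
    refine (htd k ⟨j, by omega⟩).trans_le (le_trans ?_ hN.le)
    exact Nat.one_div_le_one_div (by omega)
  have h4 := dist_triangle4 (U (t k) f) (U (t k) (g j)) (g j) f
  rw [(hU (t k)).dist_eq, dist_comm (g j) f] at h4
  change dist (U (t k) f) f < ε
  have hj' : dist f (g j) < ε / 3 := hj
  linarith

/-! ### Sequence entropy -/

section SequenceEntropy

variable {X : Type*} [MeasurableSpace X] {T : X → X} {μ : Measure X}

/-- A partition consists of the fibres of a function. -/
theorem IsMeasurablePartition.exists_label {ι : Type*} {ξ : ι → Set X}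
    (hξ : IsMeasurablePartition ξ) : ∃ L : X → ι, ∀ i, L ⁻¹' {i} = ξ i := by
  have hex : ∀ x, ∃ i, x ∈ ξ i := fun x => Set.mem_iUnion.1 (hξ.iUnion_eq ▸ Set.mem_univ x)
  choose L hL using hex
  refine ⟨L, fun i => Set.ext fun x => ⟨fun hx => ?_, fun hx => ?_⟩⟩
  · rw [Set.mem_preimage, Set.mem_singleton_iff] at hx
    exact hx ▸ hL x
  · by_contra hne
    exact Set.disjoint_left.1 (hξ.disjoint hne) (hL x) hx

theorem partitionEntropy_joinAlong {ι : Type*} [Fintype ι] {ξ : ι → Set X} {L : X → ι}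
    (hL : ∀ i, L ⁻¹' {i} = ξ i) (s : ℕ → ℕ) (n : ℕ) :
    partitionEntropy μ (joinAlong T s ξ n) =
      fiberEntropy μ (fun x (i : Fin n) => L (T^[s i] x)) := by
  rw [partitionEntropy, fiberEntropy, ← Finset.sum_neg_distrib]
  refine Finset.sum_congr rfl fun w _ => ?_
  have : joinAlong T s ξ n w = (fun x (i : Fin n) => L (T^[s i] x)) ⁻¹' {w} := by
    ext x
    simp [joinAlong, ← hL, funext_iff]
  rw [this, Real.negMulLog, neg_mul]

theorem seqEntropyOf_nonneg [IsProbabilityMeasure μ] {ι : Type*} [Fintype ι] {ξ : ι → Set X}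
    (hξ : IsMeasurablePartition ξ) (s : ℕ → ℕ) : 0 ≤ seqEntropyOf T μ s ξ := by
  obtain ⟨L, hL⟩ := hξ.exists_label
  refine le_limsup_of_frequently_le (Frequently.of_forall fun n => ?_)
  rw [partitionEntropy_joinAlong hL]
  exact_mod_cast mul_nonneg (by positivity) (fiberEntropy_nonneg _)

/-- Functions with values in `Fin k` that are close in `L²` agree up to a set of small measure. -/
theorem measureReal_ne_le_of_dist_lt {k : ℕ} {f g : X → Fin k} {F G : Lp ℂ 2 μ}
    (hF : F =ᵐ[μ] fun x => ((f x : ℕ) : ℂ)) (hG : G =ᵐ[μ] fun x => ((g x : ℕ) : ℂ)) {δ : ℝ}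
    (h : dist F G < δ) : μ.real {x | f x ≠ g x} ≤ δ ^ 2 := by
  have hδ : 0 ≤ δ := dist_nonneg.trans h.le
  -- Distinct labels are integers at distance at least 1, so Chebyshev's inequality is used at level
  -- 1.
  have hcheb := mul_meas_ge_le_pow_eLpNorm' μ (p := 2) (by norm_num) (by norm_num)
    (Lp.aestronglyMeasurable (F - G)) 1
  rw [ENNReal.one_rpow, one_mul, ← Lp.enorm_def, ← edist_eq_enorm_sub, edist_dist] at hcheb
  have hsub : μ {x | f x ≠ g x} ≤ μ {x | 1 ≤ ‖(F - G : Lp ℂ 2 μ) x‖ₑ} := by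
    refine measure_mono_ae ?_
    filter_upwards [hF, hG, Lp.coeFn_sub F G] with x hFx hGx hx hne
    change 1 ≤ ‖(F - G : Lp ℂ 2 μ) x‖ₑ
    rw [hx, Pi.sub_apply, hFx, hGx, ← ofReal_norm, ENNReal.one_le_ofReal]
    have hne' : ((f x : ℕ) : ℤ) - ((g x : ℕ) : ℤ) ≠ 0 := by
      rw [sub_ne_zero]
      exact_mod_cast fun e => hne (Fin.ext e)
    have := Int.one_le_abs hne'
    have e : ((f x : ℕ) : ℂ) - ((g x : ℕ) : ℂ) =
      ((((f x : ℕ) : ℤ) - ((g x : ℕ) : ℤ) : ℤ) : ℂ) := by push_cast; rfl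
    rw [e, Complex.norm_intCast]
    exact_mod_cast this
  rw [measureReal_def]
  refine ENNReal.toReal_le_of_le_ofReal (by positivity) ((hsub.trans hcheb).trans ?_)
  rw [ENNReal.toReal_ofNat, ENNReal.rpow_ofNat, ← ENNReal.ofReal_pow dist_nonneg]
  exact ENNReal.ofReal_le_ofReal (pow_le_pow_left₀ dist_nonneg h.le 2)

theorem seqEntropyOf_le_of_totallyBounded_orbit [IsProbabilityMeasure μ] (hT : MeasurePreserving T μ μ) {s a : ℕ → ℕ}
    (hsa : IsSubseqOf s a)
    (h : ∀ f : Lp ℂ 2 μ, TotallyBounded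
      (Set.range fun n => Lp.compMeasurePreserving (T^[a n]) (hT.iterate (a n)) f))
    {k : ℕ} {ξ : Fin k → Set X} (hξ : IsMeasurablePartition ξ) {ε : ℝ} (hε : 0 < ε) :
    seqEntropyOf T μ s ξ ≤ ε := by
  obtain ⟨φ, -, rfl⟩ := hsa
  obtain ⟨L, hL⟩ := hξ.exists_label
  have hLm : MeasurableFibers L := fun i => hL i ▸ hξ.measurableSet i
  have hLmeas : Measurable L := measurable_to_countable' hLm
  have hLp : MemLp (fun x => ((L x : ℕ) : ℂ)) 2 μ := by
    refine MemLp.of_bound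
      ((measurable_of_countable (fun i : Fin k => ((i : ℕ) : ℂ))).comp hLmeas).aestronglyMeasurable
      (k : ℝ) (ae_of_all _ fun x => ?_)
    rw [Complex.norm_natCast]
    exact_mod_cast (L x).2.le
  obtain ⟨δ, hδ, hmis⟩ := exists_fiberEntropy_mismatch_le μ (Fin k) (half_pos hε)
  -- Squaring this radius bounds the mismatch measure by `δ / 2 < δ`.
  obtain ⟨F, hF⟩ := exists_finset_of_totallyBounded_range (h (hLp.toLp _)) (ε := √(δ / 2))
    (by positivity)
  choose c hcF hc using hF
  have hcoe : ∀ j, (Lp.compMeasurePreserving (T^[j]) (hT.iterate j) (hLp.toLp _) : X → ℂ) =ᵐ[μ]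
      fun x => ((L (T^[j] x) : ℕ) : ℂ) := fun j =>
    (Lp.coeFn_compMeasurePreserving _ _).trans
      ((hT.iterate j).quasiMeasurePreserving.ae_eq_comp hLp.coeFn_toLp)
  have hm : ∀ j, MeasurableFibers fun x => L (T^[j] x) := fun j =>
    hLm.comp_measurable (hT.iterate j).measurable
  have hgrow := fiberEntropy_pi_le (μ := μ) (f := fun n x => L (T^[a (φ n)] x))
    (g := fun (b : F) x => L (T^[a b] x)) (fun n => hm _) (fun b => hm _) (ε := ε / 2)
    (fun n => ⟨c (φ n), hcF (φ n)⟩) fun n => by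
      refine hmis _ _ (hm _) (hm _) ?_
      refine (measureReal_ne_le_of_dist_lt (hcoe _) (hcoe _) (hc (φ n))).trans_lt ?_
      rw [Real.sq_sqrt (by positivity)]
      linarith
  set C := fiberEntropy μ (fun x (b : F) => L (T^[a b] x)) with hC
  obtain ⟨N, hN⟩ := exists_nat_gt (C / (ε / 2))
  refine limsup_le_of_le (h := ?_)
  -- `C` does not depend on `n`, so `C / n < ε / 2` here; starting at `N + 1` also excludes `n = 0`.
  filter_upwards [eventually_ge_atTop (N + 1)] with n hn
  rw [partitionEntropy_joinAlong hL, EReal.coe_le_coe_iff, one_div,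
    inv_mul_le_iff₀ (by exact_mod_cast (by omega : 0 < n))]
  refine (hgrow n).trans ?_
  rw [div_lt_iff₀ (by positivity)] at hN
  have hNn : (N : ℝ) ≤ n := by exact_mod_cast (by omega : N ≤ n)
  nlinarith

theorem seqEntropy_eq_zero_of_totallyBounded_orbit [IsProbabilityMeasure μ] (hT : MeasurePreserving T μ μ) {s a : ℕ → ℕ}
    (hsa : IsSubseqOf s a)
    (h : ∀ f : Lp ℂ 2 μ, TotallyBounded
      (Set.range fun n => Lp.compMeasurePreserving (T^[a n]) (hT.iterate (a n)) f)) :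
    seqEntropy T μ s = 0 := by
  refine le_antisymm (iSup_le fun k => iSup₂_le fun ξ hξ => ?_) ?_
  · refine EReal.le_of_forall_lt_iff_le.1 fun ε hε => ?_
    exact seqEntropyOf_le_of_totallyBounded_orbit hT hsa h hξ (by exact_mod_cast hε)
  -- An empty supremum in `EReal` is `⊥`, so the lower bound needs an actual partition.
  · have htriv : IsMeasurablePartition fun _ : Fin 1 => (Set.univ : Set X) :=
      ⟨fun _ => .univ, fun i j hij => (hij (Subsingleton.elim i j)).elim, Set.iUnion_const _⟩
    exact (seqEntropyOf_nonneg (T := T) htriv s).trans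
      (le_iSup_of_le 1 (le_iSup₂_of_le _ htriv le_rfl))

end SequenceEntropy

end MeasureRigidity

theorem theorem3p5 {X : Type*} [MetricSpace X] [CompactSpace X] [Nonempty X]
    [MeasurableSpace X] [BorelSpace X] (T : X ≃ₜ X)
    (μ : Measure X) [IsProbabilityMeasure μ] (hT : MeasurePreserving T μ μ)
    (a : ℕ → ℕ) (ha : MeasureRigidity.IsSubseqNat a)
    (hequi : MeasureRigidity.MeasureEquicontinuousAlong T μ a) :
    (∀ s : ℕ → ℕ, MeasureRigidity.IsSubseqOf s a → MeasureRigidity.seqEntropy T μ s = 0) ∧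
      MeasureRigidity.IsRigid hT := by
  have horbit := hequi.totallyBounded_orbit hT
  -- Instance search uses this for the separability of `Lp ℂ 2 μ`.
  have : Fact ((2 : ENNReal) ≠ ⊤) := ⟨by norm_num⟩
  exact ⟨fun s hs => MeasureRigidity.seqEntropy_eq_zero_of_totallyBounded_orbit hT hs horbit,
    MeasureRigidity.isRigid_of_totallyBounded_orbit hT ha horbit⟩
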